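/- Theorem. Let $\mathbb{T}^2(\mathbb{H})=\{(x,y)\in\mathbb{H}^2 : |x|=|y|=1\}$ with its probability Haar measure $\mu$, and let $P(x,y)=\sum_{\ell,m} x^{\ell}y^{m}a_{\ell,m}$ (a finite sum, $a_{\ell,m}\in\mathbb{H}$) be a non-zero slice regular quaternionic polynomial in two variables. Then: (1) there are constants $C,\delta>0$, depending only on $P$, such that for all $\varepsilon>0$ $$\mu\big(\{(x,y)\in\mathbb{T}^2(\mathbb{H}) : |P(x,y)|\le\varepsilon\}\big)\le C\,\varepsilon^{\delta};$$ (2) the Mahler measure $$m_{\mathbb{H}}(P)=\int_{\mathbb{T}^2(\mathbb{H})}\log|P(x,y)|\,d\mu$$ converges absolutely, and exists as an improper Riemann integral: the zero set of $P$ in $\mathbb{T}^2(\mathbb{H})$ is $\mu$-null; its complement $E$ is the union of an increasing sequence of sets $K_n$ with $\mu$-null boundary over each of which $\log|P|$ is bounded and Riemann integrable; and for every such sequence $(K_n)$ one has $\int_{K_n}\log|P|\,d\mu\to m_{\mathbb{H}}(P)$. (A bounded function on $\mathbb{T}^2(\mathbb{H})$ is Riemann integrable if its Riemann sums over tagged finite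 partitions into sets with $\mu$-null boundary converge as the mesh tends to $0$; integrability over $K_n$ is that of the function extended by $0$.) -/

import Mathlib

open scoped Quaternion

namespace QuaternionMahler

/-- The group of unit quaternions, the unit sphere of `ℍ` with quaternion multiplication. -/
abbrev UnitQuaternion : Type := Metric.sphere (0 : ℍ) 1

noncomputable instance : MeasurableSpace UnitQuaternion := borel UnitQuaternion

instance : BorelSpace UnitQuaternion := ⟨rfl⟩

instance : CompactSpace UnitQuaternion :=
  haveI : ProperSpace ℍ := FiniteDimensional.proper ℝ ℍ
  inferInstance

/-- The unit quaternion torus `T²(ℍ) = {(x, y) ∈ ℍ² : |x| = |y| = 1}`. -/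
abbrev Torus : Type := UnitQuaternion × UnitQuaternion

/-- The Haar measure of the compact group `T²(ℍ)` of total mass one. -/
noncomputable def torusMeasure : MeasureTheory.Measure Torus :=
  MeasureTheory.Measure.haarMeasure ⊤

/-- Slice regular polynomials in two variables: the functions on `ℍ²` of the form
`P(x, y) = ∑ x ^ ℓ₁ * y ^ ℓ₂ * a_{ℓ₁, ℓ₂}`, a finite sum with quaternionic coefficients. -/
def IsSliceRegularPolynomial (P : ℍ → ℍ → ℍ) : Prop :=
  ∃ a : ℕ × ℕ →₀ ℍ, ∀ x y : ℍ, P x y = a.sum fun l c => x ^ l.1 * y ^ l.2 * c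

/-- The function `log |P|` on the torus (of interest where `P ≠ 0`). -/
noncomputable def logAbs (P : ℍ → ℍ → ℍ) (p : Torus) : ℝ :=
  Real.log ‖P p.1 p.2‖

/-- The set of the points of the torus where `log |P|` is finite. -/
def regularSet (P : ℍ → ℍ → ℍ) : Set Torus := {p | P p.1 p.2 ≠ 0}

/-- The quaternionic Mahler measure `m_ℍ(P) = ∫ log |P| dμ` over `T²(ℍ)`. -/
noncomputable def mahlerMeasure (P : ℍ → ℍ → ℍ) : ℝ :=
  ∫ p, logAbs P p ∂torusMeasure

section Riemann

variable {X : Type*} [PseudoMetricSpace X] [MeasurableSpace X]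

/-- Jordan measurability of a subset of a compact space with a finite Borel measure:
the boundary is negligible. -/
def JordanMeasurable (μ : MeasureTheory.Measure X) (A : Set X) : Prop :=
  μ (frontier A) = 0

/-- A finite partition of the space into Jordan measurable pieces, with a tag in each piece. -/
structure TaggedPartition (μ : MeasureTheory.Measure X) where
  size : ℕ
  piece : Fin size → Set X
  jordan : ∀ i, JordanMeasurable μ (piece i)
  disjoint : Pairwise fun i j => Disjoint (piece i) (piece j)
  cover : ⋃ i, piece i = Set.univ
  tag : Fin size → X
  tag_mem : ∀ i, tag i ∈ piece i

/-- The pieces have diameter less than `d`. -/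
def TaggedPartition.FinerThan {μ : MeasureTheory.Measure X} (π : TaggedPartition μ)
    (d : ℝ) : Prop :=
  ∀ i, ∀ x ∈ π.piece i, ∀ y ∈ π.piece i, dist x y < d

/-- The Riemann sum `∑ f(tᵢ) μ(Aᵢ)`. -/
noncomputable def TaggedPartition.riemannSum {μ : MeasureTheory.Measure X}
    (π : TaggedPartition μ) (f : X → ℝ) : ℝ :=
  ∑ i, f (π.tag i) * μ.real (π.piece i)

/-- `f` is bounded and (properly) Riemann integrable over the compact space `X` with respect
to `μ`, with integral `L`: the Riemann sums tend to `L` as the mesh tends to zero. -/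
def HasRiemannIntegral (μ : MeasureTheory.Measure X) (f : X → ℝ) (L : ℝ) : Prop :=
  (∃ M : ℝ, ∀ x, |f x| ≤ M) ∧
    ∀ η > 0, ∃ d > 0, ∀ π : TaggedPartition μ, π.FinerThan d → |π.riemannSum f - L| < η

/-- An exhaustion of `E` by an increasing sequence of Jordan measurable sets `K n` over each of
which `f` has a proper Riemann integral, equal to `I n`. -/
structure IsRiemannExhaustion (μ : MeasureTheory.Measure X) (E : Set X) (f : X → ℝ)
    (K : ℕ → Set X) (I : ℕ → ℝ) : Prop where
  mono : Monotone K
  iUnion_eq : ⋃ n, K n = E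
  jordan : ∀ n, JordanMeasurable μ (K n)
  hasRiemannIntegral : ∀ n, HasRiemannIntegral μ ((K n).indicator f) (I n)

/-- The improper Riemann integral over `X` of a function `f` that is singular off `E` exists and
equals `L`: the singular set is negligible, `E` can be exhausted by sets over which `f` is
properly Riemann integrable, and for every such exhaustion the integrals tend to `L`. -/
def HasImproperRiemannIntegral (μ : MeasureTheory.Measure X) (E : Set X) (f : X → ℝ)
    (L : ℝ) : Prop :=
  μ Eᶜ = 0 ∧
    (∃ (K : ℕ → Set X) (I : ℕ → ℝ), IsRiemannExhaustion μ E f K I) ∧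
    ∀ (K : ℕ → Set X) (I : ℕ → ℝ), IsRiemannExhaustion μ E f K I →
      Filter.Tendsto I Filter.atTop (nhds L)

end Riemann

end QuaternionMahler

open QuaternionMahler

/-!
For fixed `y`, the conjugate of `P(x, y)` is a one-variable quaternionic polynomial in `star x`.
The symmetrization of such a polynomial has real coefficients, so its norm at a unit quaternion `x`
depends only on `Re x` and is the norm of its value at a complex number with the same real part. A
small value therefore forces `Re x` to be close to the real part of one of finitely many complex
roots, and a slab `|Re x - a| ≤ r` of the unit quaternions has measure `O(√r)`. The resulting power
bound is uniform in `y` up to the size of the leading coefficient, which is itself a one-variable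
polynomial in `star y`, so Fubini's theorem yields the bound in two variables.

The power bound makes `log |P|` integrable by the layer cake formula. The improper Riemann integral
then comes from Lebesgue's criterion: a bounded function that is continuous almost everywhere is
Riemann integrable, all but countably many sublevel sets of `|P|` have null boundary, and dominated
convergence identifies the limit over any exhaustion.
-/

namespace QuaternionMahler

open MeasureTheory Filter Topology Set

section Riemann

variable {X : Type*} [PseudoMetricSpace X] [MeasurableSpace X] {μ : Measure X}

theorem JordanMeasurable.diff {A B : Set X} (hA : JordanMeasurable μ A)
    (hB : JordanMeasurable μ B) : JordanMeasurable μ (A \ B) := by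
  have hsub : frontier (A \ B) ⊆ frontier A ∪ frontier B := by
    rw [sdiff_eq, ← frontier_compl B]
    exact (frontier_inter_subset A Bᶜ).trans
      (union_subset_union inter_subset_left inter_subset_right)
  exact measure_mono_null hsub (measure_union_null hA hB)

theorem JordanMeasurable.nullMeasurableSet [OpensMeasurableSpace X] {A : Set X}
    (hA : JordanMeasurable μ A) : NullMeasurableSet A μ :=
  nullMeasurableSet_of_null_frontier hA

theorem JordanMeasurable.ae_continuousAt_indicator {A : Set X} (hA : JordanMeasurable μ A)
    {f : X → ℝ} (hf : ContinuousOn f A) : ∀ᵐ x ∂μ, ContinuousAt (A.indicator f) x := by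
  filter_upwards [measure_eq_zero_iff_ae_notMem.1 hA] with x hx
  exact (hf.mono interior_subset).continuousAt_indicator hx

theorem exists_taggedPartition_of_finite_partition {ι : Type*} [Finite ι] {A : ι → Set X}
    (hA : ∀ i, JordanMeasurable μ (A i)) (hdisj : Pairwise fun i j => Disjoint (A i) (A j))
    (hcover : ⋃ i, A i = univ) : ∃ π : TaggedPartition μ, ∀ k, ∃ i, π.piece k = A i := by
  obtain ⟨n, ⟨e⟩⟩ := Finite.exists_equiv_fin {i // (A i).Nonempty}
  have hcover' : ⋃ k, A (e.symm k) = univ := eq_univ_of_forall fun x => by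
    obtain ⟨i, hi⟩ := mem_iUnion.1 (hcover ▸ mem_univ x)
    exact mem_iUnion.2 ⟨e ⟨i, x, hi⟩, by simpa using hi⟩
  exact ⟨{  size := n
            piece := fun k => A (e.symm k)
            jordan := fun k => hA _
            disjoint := fun k l hkl => hdisj fun h => hkl (e.symm.injective (Subtype.ext h))
            cover := hcover'
            tag := fun k => (e.symm k).2.some
            tag_mem := fun k => (e.symm k).2.some_mem }, fun k => ⟨_, rfl⟩⟩

theorem exists_jordanMeasurable_ball [OpensMeasurableSpace X] (μ : Measure X) [SFinite μ]
    {d : ℝ} (hd : 0 < d) (x : X) :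
    ∃ r, 0 < r ∧ r < d ∧ JordanMeasurable μ (Metric.ball x r) := by
  obtain ⟨r, hr, h⟩ := exists_null_frontier_thickening μ {x} hd
  exact ⟨r, hr.1, hr.2, by rwa [Metric.thickening_singleton] at h⟩

theorem exists_taggedPartition_finerThan [OpensMeasurableSpace X] [CompactSpace X]
    (μ : Measure X) [SFinite μ] {d : ℝ} (hd : 0 < d) :
    ∃ π : TaggedPartition μ, π.FinerThan d := by
  choose r hr0 hrd hrJ using exists_jordanMeasurable_ball μ (half_pos hd)
  obtain ⟨t, ht⟩ := isCompact_univ.elim_finite_subcover (fun x => Metric.ball x (r x))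
    (fun _ => Metric.isOpen_ball) fun x _ => mem_iUnion.2 ⟨x, Metric.mem_ball_self (hr0 x)⟩
  let B : Fin t.card → Set X := fun i => Metric.ball (t.equivFin.symm i) (r (t.equivFin.symm i))
  have hB : ⋃ i, B i = univ := eq_univ_of_forall fun x => by
    obtain ⟨z, hz, hxz⟩ := mem_iUnion₂.1 (ht (mem_univ x))
    exact mem_iUnion.2 ⟨t.equivFin ⟨z, hz⟩, by simpa [B] using hxz⟩
  obtain ⟨π, hπ⟩ := exists_taggedPartition_of_finite_partition (A := disjointed B)
    (fun _ => disjointedRec (fun _ _ h => h.diff (hrJ _)) (hrJ _))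
    (disjoint_disjointed B) (iUnion_disjointed.trans hB)
  refine ⟨π, fun k x hx y hy => ?_⟩
  obtain ⟨i, hi⟩ := hπ k
  have hxB : x ∈ B i := disjointed_subset B i (hi ▸ hx)
  have hyB : y ∈ B i := disjointed_subset B i (hi ▸ hy)
  calc dist x y ≤ dist x (t.equivFin.symm i) + dist y (t.equivFin.symm i) :=
        dist_triangle_right _ _ _
    _ < d / 2 + d / 2 := add_lt_add (hxB.trans (hrd _)) (hyB.trans (hrd _))
    _ = d := add_halves d

theorem HasRiemannIntegral.unique [OpensMeasurableSpace X] [CompactSpace X] [SFinite μ]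
    {f : X → ℝ} {L L' : ℝ} (h : HasRiemannIntegral μ f L) (h' : HasRiemannIntegral μ f L') :
    L = L' := by
  refine eq_of_forall_dist_le fun η hη => ?_
  obtain ⟨d, hd, H⟩ := h.2 (η / 2) (half_pos hη)
  obtain ⟨d', hd', H'⟩ := h'.2 (η / 2) (half_pos hη)
  obtain ⟨π, hπ⟩ := exists_taggedPartition_finerThan μ (lt_min hd hd')
  have hL : |π.riemannSum f - L| < η / 2 :=
    H π fun i x hx y hy => (hπ i x hx y hy).trans_le (min_le_left _ _)
  have hL' : |π.riemannSum f - L'| < η / 2 :=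
    H' π fun i x hx y hy => (hπ i x hx y hy).trans_le (min_le_right _ _)
  calc dist L L' ≤ |π.riemannSum f - L| + |π.riemannSum f - L'| := by
        rw [abs_sub_comm _ L]
        exact abs_sub_le _ _ _
    _ ≤ η := by linarith

namespace TaggedPartition

/-- The step function of a tagged partition, equal to `f (tag i)` on the piece of index `i`, whose
Lebesgue integral is the Riemann sum of `f`. -/
noncomputable def step (π : TaggedPartition μ) (f : X → ℝ) : X → ℝ :=
  ∑ i, (π.piece i).indicator fun _ => f (π.tag i)

theorem exists_mem_piece_step_eq (π : TaggedPartition μ) (f : X → ℝ) (x : X) :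
    ∃ i, x ∈ π.piece i ∧ π.step f x = f (π.tag i) := by
  obtain ⟨i, hi⟩ := mem_iUnion.1 (π.cover ▸ mem_univ x)
  refine ⟨i, hi, ?_⟩
  rw [step, Finset.sum_apply, Finset.sum_eq_single_of_mem i (Finset.mem_univ i),
    indicator_of_mem hi]
  exact fun j _ hj => indicator_of_notMem (disjoint_right.1 (π.disjoint hj) hi) _

theorem integrable_indicator_piece [OpensMeasurableSpace X] [IsFiniteMeasure μ]
    (π : TaggedPartition μ) (c : ℝ) (i : Fin π.size) :
    Integrable ((π.piece i).indicator fun _ => c) μ :=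
  (integrable_const c).indicator₀ (π.jordan i).nullMeasurableSet

theorem integrable_step [OpensMeasurableSpace X] [IsFiniteMeasure μ] (π : TaggedPartition μ)
    (f : X → ℝ) : Integrable (π.step f) μ :=
  integrable_finsetSum' _ fun i _ => π.integrable_indicator_piece _ i

theorem integral_step [OpensMeasurableSpace X] [IsFiniteMeasure μ] (π : TaggedPartition μ)
    (f : X → ℝ) : ∫ x, π.step f x ∂μ = π.riemannSum f := by
  simp only [step, Finset.sum_apply]
  rw [integral_finsetSum _ fun i _ => π.integrable_indicator_piece _ i, riemannSum]
  refine Finset.sum_congr rfl fun i _ => ?_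
  rw [integral_indicator₀ (π.jordan i).nullMeasurableSet, setIntegral_const, smul_eq_mul,
    mul_comm]

theorem tendsto_step_of_continuousAt {π : ℕ → TaggedPartition μ} {d : ℕ → ℝ}
    (hπ : ∀ n, (π n).FinerThan (d n)) (hd : Tendsto d atTop (𝓝 0)) {f : X → ℝ} {x : X}
    (hf : ContinuousAt f x) : Tendsto (fun n => (π n).step f x) atTop (𝓝 (f x)) := by
  choose i hxi hi using fun n => (π n).exists_mem_piece_step_eq f x
  simp only [hi]
  have htag : Tendsto (fun n => (π n).tag (i n)) atTop (𝓝 x) :=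
    tendsto_iff_dist_tendsto_zero.2 <| squeeze_zero (fun _ => dist_nonneg)
      (fun n => (hπ n (i n) _ ((π n).tag_mem _) _ (hxi n)).le) hd
  exact hf.tendsto.comp htag

end TaggedPartition

theorem hasRiemannIntegral_of_ae_continuousAt [OpensMeasurableSpace X] [IsFiniteMeasure μ]
    {f : X → ℝ} {M : ℝ} (hM : ∀ x, |f x| ≤ M) (hc : ∀ᵐ x ∂μ, ContinuousAt f x) :
    HasRiemannIntegral μ f (∫ x, f x ∂μ) := by
  refine ⟨⟨M, hM⟩, ?_⟩
  by_contra! hcon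
  obtain ⟨η, hη, hfar⟩ := hcon
  choose π hπ hπη using fun n : ℕ => hfar (1 / ((n : ℝ) + 1)) (by positivity)
  have hbound : ∀ n, ∀ᵐ x ∂μ, ‖(π n).step f x‖ ≤ M := fun n => Eventually.of_forall fun x => by
    obtain ⟨i, -, hi⟩ := (π n).exists_mem_piece_step_eq f x
    exact hi ▸ hM _
  have hlim : Tendsto (fun n => (π n).riemannSum f) atTop (𝓝 (∫ x, f x ∂μ)) := by
    simp only [← TaggedPartition.integral_step]
    refine tendsto_integral_of_dominated_convergence (fun _ => M)
      (fun n => ((π n).integrable_step f).aestronglyMeasurable) (integrable_const M) hbound ?_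
    exact hc.mono fun x hx =>
      TaggedPartition.tendsto_step_of_continuousAt hπ tendsto_one_div_add_atTop_nhds_zero_nat hx
  obtain ⟨n, hn⟩ := (Metric.tendsto_nhds.1 hlim η hη).exists
  exact absurd hn (not_lt.2 (hπη n))

theorem IsRiemannExhaustion.tendsto_integral [OpensMeasurableSpace X] [CompactSpace X]
    [IsFiniteMeasure μ] {E : Set X} {f : X → ℝ} {K : ℕ → Set X} {I : ℕ → ℝ}
    (h : IsRiemannExhaustion μ E f K I) (hE : μ Eᶜ = 0) (hc : ContinuousOn f E)
    (hf : Integrable f μ) : Tendsto I atTop (𝓝 (∫ x, f x ∂μ)) := by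
  have hI : ∀ n, I n = ∫ x in K n, f x ∂μ := fun n => by
    obtain ⟨M, hM⟩ := (h.hasRiemannIntegral n).1
    have hKE : K n ⊆ E := h.iUnion_eq ▸ subset_iUnion K n
    rw [← integral_indicator₀ (h.jordan n).nullMeasurableSet]
    exact (h.hasRiemannIntegral n).unique <| hasRiemannIntegral_of_ae_continuousAt hM <|
      (h.jordan n).ae_continuousAt_indicator (hc.mono hKE)
  have hlim := tendsto_setIntegral_of_monotone₀ (fun n => (h.jordan n).nullMeasurableSet)
    h.mono hf.integrableOn
  rw [h.iUnion_eq, Measure.restrict_eq_self_of_ae_mem (mem_ae_iff.2 hE)] at hlim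
  exact hlim.congr fun n => (hI n).symm

end Riemann

section LogarithmicSingularity

variable {X : Type*} [PseudoMetricSpace X] [MeasurableSpace X] [OpensMeasurableSpace X]
  {μ : Measure X} {g : X → ℝ}

theorem exists_antitone_tendsto_zero_null_levelSets [SFinite μ] (hg : Continuous g) :
    ∃ r : ℕ → ℝ, Antitone r ∧ (∀ n, 0 < r n) ∧ Tendsto r atTop (𝓝 0) ∧
      ∀ n, μ {x | g x = r n} = 0 := by
  have hcount : {t : ℝ | 0 < μ {x | g x = t}}.Countable :=
    Measure.countable_meas_level_set_pos hg.measurable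
  obtain ⟨r, hranti, hr, hrlim⟩ :=
    (hcount.dense_compl ℝ).exists_seq_strictAnti_tendsto 0
  exact ⟨r, hranti.antitone, fun n => (hr n).1, hrlim, fun n => by simpa using (hr n).2⟩

theorem hasRiemannIntegral_indicator_log [CompactSpace X] [IsFiniteMeasure μ] (hg : Continuous g)
    {r : ℝ} (hr : 0 < r) (hK : JordanMeasurable μ {x | r ≤ g x}) :
    ∃ L, HasRiemannIntegral μ ({x | r ≤ g x}.indicator fun x => Real.log (g x)) L := by
  have hcont : ContinuousOn (fun x => Real.log (g x)) {x | r ≤ g x} :=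
    hg.continuousOn.log fun x hx => (hr.trans_le hx).ne'
  obtain ⟨M, hM⟩ := (isClosed_le continuous_const hg).isCompact.exists_bound_of_continuousOn hcont
  refine ⟨_, hasRiemannIntegral_of_ae_continuousAt (M := max M 0) (fun x => ?_)
    (hK.ae_continuousAt_indicator hcont)⟩
  by_cases hx : x ∈ {x | r ≤ g x}
  · rw [indicator_of_mem hx]
    exact le_max_of_le_left (hM x hx)
  · simp only [indicator_of_notMem hx, abs_zero, le_max_right]

theorem exists_isRiemannExhaustion_log [CompactSpace X] [IsFiniteMeasure μ] (hg : Continuous g)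
    (hg0 : ∀ x, 0 ≤ g x) :
    ∃ K I, IsRiemannExhaustion μ {x | g x ≠ 0} (fun x => Real.log (g x)) K I := by
  obtain ⟨r, hranti, hr, hrlim, hnull⟩ :=
    exists_antitone_tendsto_zero_null_levelSets (μ := μ) hg
  have hJ : ∀ n, JordanMeasurable μ {x | r n ≤ g x} := fun n =>
    measure_mono_null ((frontier_le_subset_eq continuous_const hg).trans fun _ hx => hx.symm)
      (hnull n)
  choose I hI using fun n => hasRiemannIntegral_indicator_log hg (hr n) (hJ n)
  refine ⟨fun n => {x | r n ≤ g x}, I, fun m n hmn x hx => (hranti hmn).trans hx, ?_, hJ, hI⟩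
  ext x
  simp only [mem_iUnion, mem_ofPred_eq]
  refine ⟨fun ⟨n, hn⟩ => ((hr n).trans_le hn).ne', fun hx => ?_⟩
  exact ((hrlim.eventually_lt_const ((hg0 x).lt_of_ne' hx)).exists).imp fun _ h => h.le

theorem hasImproperRiemannIntegral_log [CompactSpace X] [IsFiniteMeasure μ] (hg : Continuous g)
    (hg0 : ∀ x, 0 ≤ g x) (hnull : μ {x | g x = 0} = 0)
    (hint : Integrable (fun x => Real.log (g x)) μ) :
    HasImproperRiemannIntegral μ {x | g x ≠ 0} (fun x => Real.log (g x))
      (∫ x, Real.log (g x) ∂μ) := by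
  have hE : μ {x | g x ≠ 0}ᶜ = 0 := by simpa only [compl_ofPred, not_not] using hnull
  exact ⟨hE, exists_isRiemannExhaustion_log hg hg0, fun _ _ h =>
    h.tendsto_integral hE (hg.continuousOn.log fun _ hx => hx) hint⟩

end LogarithmicSingularity

/-- Sublevel sets of `g` have measure at most a constant times a positive power of the level. -/
def HasPowerSublevelBound {X : Type*} [MeasurableSpace X] (μ : Measure X) (g : X → ℝ) : Prop :=
  ∃ C : ℝ, 0 < C ∧ ∃ δ : ℝ, 0 < δ ∧ ∀ ε : ℝ, 0 < ε → μ.real {x | g x ≤ ε} ≤ C * ε ^ δ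

namespace HasPowerSublevelBound

variable {X : Type*} [MeasurableSpace X] {μ : Measure X} {g : X → ℝ}

theorem of_forall_le_one [IsFiniteMeasure μ] {C δ : ℝ} (hC : 0 ≤ C) (hδ : 0 < δ)
    (h : ∀ ε : ℝ, 0 < ε → ε ≤ 1 → μ.real {x | g x ≤ ε} ≤ C * ε ^ δ) :
    HasPowerSublevelBound μ g := by
  have huniv : 0 ≤ μ.real univ := measureReal_nonneg
  refine ⟨C + μ.real univ + 1, by positivity, δ, hδ, fun ε hε => ?_⟩
  rcases le_total ε 1 with hε1 | hε1
  · exact (h ε hε hε1).trans (by gcongr; linarith)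
  · calc μ.real {x | g x ≤ ε} ≤ μ.real univ := measureReal_mono (subset_univ _)
      _ ≤ (C + μ.real univ + 1) * 1 := by linarith
      _ ≤ (C + μ.real univ + 1) * ε ^ δ := by gcongr; exact Real.one_le_rpow hε1 hδ.le

theorem measure_le_zero [IsFiniteMeasure μ] (h : HasPowerSublevelBound μ g) :
    μ {x | g x ≤ 0} = 0 := by
  obtain ⟨C, -, δ, hδ, h⟩ := h
  have hlim : Tendsto (fun ε : ℝ => C * ε ^ δ) (𝓝[>] 0) (𝓝 0) := by
    have h0 := (Real.continuousAt_rpow_const 0 δ (.inr hδ.le)).tendsto.const_mul C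
    rw [Real.zero_rpow hδ.ne', mul_zero] at h0
    exact h0.mono_left nhdsWithin_le_nhds
  refine (measureReal_eq_zero_iff).1 (le_antisymm (ge_of_tendsto hlim ?_) measureReal_nonneg)
  filter_upwards [self_mem_nhdsWithin] with ε (hε : 0 < ε)
  exact (measureReal_mono fun x (hx : g x ≤ 0) => hx.trans hε.le).trans (h ε hε)

theorem sq (h : HasPowerSublevelBound μ g) [IsFiniteMeasure μ] :
    HasPowerSublevelBound μ fun x => g x ^ 2 := by
  obtain ⟨C, hC, δ, hδ, h⟩ := h
  refine ⟨C, hC, 1 / 2 * δ, by positivity, fun ε hε => ?_⟩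
  rw [Real.rpow_mul hε.le, ← Real.sqrt_eq_rpow]
  exact (measureReal_mono fun x hx => (le_abs_self _).trans (Real.abs_le_sqrt hx)).trans
    (h _ (Real.sqrt_pos.2 hε))

theorem integrable_posLog_inv [IsFiniteMeasure μ] (h : HasPowerSublevelBound μ g)
    (hg : Measurable g) (hg0 : ∀ x, 0 ≤ g x) : Integrable (fun x => Real.posLog (g x)⁻¹) μ := by
  obtain ⟨C, -, δ, hδ, h⟩ := h
  have hmeas : Measurable fun x => Real.posLog (g x)⁻¹ :=
    Real.continuous_posLog.measurable.comp hg.inv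
  have hnn : 0 ≤ᵐ[μ] fun x => Real.posLog (g x)⁻¹ :=
    Eventually.of_forall fun _ => Real.posLog_nonneg
  have hexp : IntegrableOn (fun t : ℝ => C * Real.exp (-δ * t)) (Ioi 0) :=
    (exp_neg_integrableOn_Ioi 0 hδ).const_mul C
  refine ⟨hmeas.aestronglyMeasurable, ?_⟩
  rw [hasFiniteIntegral_iff_ofReal hnn, lintegral_eq_lintegral_meas_le μ hnn hmeas.aemeasurable]
  refine (setLIntegral_mono' measurableSet_Ioi fun t (ht : 0 < t) => ?_).trans_lt
    hexp.lintegral_lt_top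
  have hsub : {x | t ≤ Real.posLog (g x)⁻¹} ⊆ {x | g x ≤ Real.exp (-t)} := fun x hx => by
    have hlog : t ≤ -Real.log (g x) := by
      rw [← Real.log_inv]
      exact (le_max_iff.1 hx).resolve_left (not_le.2 ht)
    rcases (hg0 x).eq_or_lt with h0 | h0
    · exact h0.symm.trans_le (Real.exp_pos _).le
    · exact (Real.log_le_iff_le_exp h0).1 (by linarith)
  rw [← ofReal_measureReal]
  refine ENNReal.ofReal_le_ofReal ((measureReal_mono hsub).trans ?_)
  rw [show -δ * t = -t * δ by ring, Real.exp_mul]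
  exact h _ (Real.exp_pos _)

theorem integrable_log [IsFiniteMeasure μ] (h : HasPowerSublevelBound μ g) (hg : Measurable g)
    (hg0 : ∀ x, 0 ≤ g x) {M : ℝ} (hM : ∀ x, g x ≤ M) :
    Integrable (fun x => Real.log (g x)) μ := by
  have hpos : Integrable (fun x => Real.posLog (g x)) μ :=
    .of_bound (Real.continuous_posLog.measurable.comp hg).aestronglyMeasurable (Real.posLog M) <|
      Eventually.of_forall fun x => by
        rw [Real.norm_of_nonneg Real.posLog_nonneg]
        exact Real.posLog_le_posLog (hg0 x) (hM x)
  simpa only [Pi.sub_def, Real.posLog_sub_posLog_inv] using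
    hpos.sub (h.integrable_posLog_inv hg hg0)

end HasPowerSublevelBound

section Product

variable {X Y : Type*} [MeasurableSpace X] [MeasurableSpace Y] {μ : Measure X} {ν : Measure Y}
  [IsFiniteMeasure μ] [IsFiniteMeasure ν]

theorem measureReal_prod_le_of_section_le {S : Set (X × Y)}
    (hS : MeasurableSet S) {T : Set Y} (hT : MeasurableSet T) {K : ℝ} (hK0 : 0 ≤ K)
    (hK : ∀ y ∉ T, μ.real {x | (x, y) ∈ S} ≤ K) :
    (μ.prod ν).real S ≤ μ.real univ * ν.real T + K * ν.real univ := by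
  have hsection : ∀ y, μ {x | (x, y) ∈ S} ≤ T.indicator (fun _ => μ univ) y + .ofReal K :=
    fun y => by
      by_cases hy : y ∈ T
      · rw [indicator_of_mem hy]
        exact (measure_mono (subset_univ _)).trans le_self_add
      · rw [indicator_of_notMem hy, zero_add, ← ofReal_measureReal]
        exact ENNReal.ofReal_le_ofReal (hK y hy)
  have h : (μ.prod ν) S ≤ μ univ * ν T + .ofReal K * ν univ := by
    rw [Measure.prod_apply_symm hS]
    refine (lintegral_mono hsection).trans_eq ?_
    rw [lintegral_add_right _ measurable_const, lintegral_indicator_const hT, lintegral_const]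
  refine ENNReal.toReal_le_of_le_ofReal (by positivity) (h.trans_eq ?_)
  rw [ENNReal.ofReal_add (by positivity) (by positivity), ENNReal.ofReal_mul (by positivity),
    ENNReal.ofReal_mul hK0, ofReal_measureReal, ofReal_measureReal, ofReal_measureReal]

theorem HasPowerSublevelBound.prod {g : X × Y → ℝ} {h : Y → ℝ} (hg : Measurable g)
    (hh : Measurable h) (hbound : HasPowerSublevelBound ν h) {C δ : ℝ} (hC : 0 ≤ C) (hδ : 0 < δ)
    (hsection : ∀ y, 0 < h y → ∀ ε : ℝ, 0 < ε → μ.real {x | g (x, y) ≤ ε} ≤ C * (ε / h y) ^ δ) :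
    HasPowerSublevelBound (μ.prod ν) g := by
  obtain ⟨D, hD, γ, hγ, hbound⟩ := hbound
  refine of_forall_le_one (C := μ.real univ * D + C * ν.real univ) (δ := 1 / 2 * min γ δ)
    (by positivity) (by positivity) fun ε hε hε1 => ?_
  set t := √ε
  have ht : 0 < t := Real.sqrt_pos.2 hε
  have ht1 : t ≤ 1 := Real.sqrt_le_one.2 hε1
  have hεt : ε / t = t := Real.div_sqrt
  have hsmall : ∀ y ∉ {y | h y ≤ t}, μ.real {x | (x, y) ∈ {p | g p ≤ ε}} ≤ C * t ^ δ := by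
    intro y hy
    have hty : t < h y := not_le.1 hy
    calc μ.real {x | g (x, y) ≤ ε} ≤ C * (ε / h y) ^ δ := hsection y (ht.trans hty) ε hε
      _ ≤ C * (ε / t) ^ δ := by
        have : 0 ≤ ε / h y := div_nonneg hε.le (ht.trans hty).le
        gcongr
      _ = C * t ^ δ := by rw [hεt]
  calc (μ.prod ν).real {p | g p ≤ ε}
      ≤ μ.real univ * ν.real {y | h y ≤ t} + C * t ^ δ * ν.real univ :=
        measureReal_prod_le_of_section_le (measurableSet_le hg measurable_const)
          (measurableSet_le hh measurable_const) (by positivity) hsmall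
    _ ≤ μ.real univ * (D * t ^ min γ δ) + C * t ^ min γ δ * ν.real univ := by
        gcongr ?_ * ?_ + _ * ?_ * _
        · exact (hbound t ht).trans (mul_le_mul_of_nonneg_left
            (Real.rpow_le_rpow_of_exponent_ge ht ht1 (min_le_left _ _)) hD.le)
        · exact Real.rpow_le_rpow_of_exponent_ge ht ht1 (min_le_right _ _)
    _ = (μ.real univ * D + C * ν.real univ) * ε ^ (1 / 2 * min γ δ) := by
        rw [Real.rpow_mul hε.le, ← Real.sqrt_eq_rpow]
        ring

end Product

section ConeVolume

theorem abs_sub_sqrt_le_sqrt {x D w : ℝ} (hx : 0 ≤ x) (h : |x ^ 2 - D| ≤ w) :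
    |x - √D| ≤ √w := by
  refine Real.abs_le_sqrt (le_trans ?_ h)
  rcases le_total 0 D with hD | hD
  · have hsum : |x - √D| ≤ x + √D :=
      (abs_sub _ _).trans_eq (by rw [abs_of_nonneg hx, abs_of_nonneg (Real.sqrt_nonneg D)])
    calc (x - √D) ^ 2 = |x - √D| * |x - √D| := by rw [abs_mul_abs_self, sq]
      _ ≤ |x - √D| * (x + √D) := by gcongr
      _ = |x ^ 2 - D| := by
        nth_rw 3 [← Real.sq_sqrt hD]
        rw [sq_sub_sq, abs_mul, mul_comm, abs_of_nonneg (add_nonneg hx (Real.sqrt_nonneg D))]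
  · rw [Real.sqrt_eq_zero_of_nonpos hD, sub_zero]
    exact le_trans (by linarith) (le_abs_self _)

theorem volume_abs_quadratic_le {p : ℝ} (hp : p ≠ 0) (q c s : ℝ) :
    volume {t : ℝ | |p * t ^ 2 + q * t + c| ≤ s} ≤ .ofReal (4 * √(s / |p|)) := by
  set m := -q / (2 * p) with hm
  set D := (q ^ 2 - 4 * p * c) / (4 * p ^ 2) with hD
  have hsub : {t : ℝ | |p * t ^ 2 + q * t + c| ≤ s} ⊆
      Metric.closedBall (m + √D) √(s / |p|) ∪ Metric.closedBall (m - √D) √(s / |p|) := by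
    intro t ht
    have hsquare : p * t ^ 2 + q * t + c = p * (|t - m| ^ 2 - D) := by
      rw [sq_abs, hm, hD]
      field_simp
      ring
    have hnear : |(|t - m| - √D)| ≤ √(s / |p|) := by
      refine abs_sub_sqrt_le_sqrt (abs_nonneg _) ?_
      rw [le_div_iff₀' (abs_pos.2 hp), ← abs_mul, ← hsquare]
      exact ht
    simp only [mem_union, Metric.mem_closedBall, Real.dist_eq]
    rcases abs_cases (t - m) with ⟨h, -⟩ | ⟨h, -⟩ <;> rw [h] at hnear
    · left
      rwa [← sub_sub]
    · right
      rwa [abs_sub_comm, show m - √D - t = -(t - m) - √D by ring]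
  calc volume {t : ℝ | |p * t ^ 2 + q * t + c| ≤ s}
      ≤ .ofReal (2 * √(s / |p|)) + .ofReal (2 * √(s / |p|)) := by
        simpa only [Real.volume_closedBall] using
          (measure_mono (μ := volume) hsub).trans (measure_union_le _ _)
    _ = .ofReal (4 * √(s / |p|)) := by
        rw [← ENNReal.ofReal_add (by positivity) (by positivity)]
        ring_nf

section LineSection

variable {E : Type*} [NormedAddCommGroup E] [NormedSpace ℝ E] [SecondCountableTopology E]
  [MeasurableSpace E] [BorelSpace E] {μ : Measure E} [SFinite μ] [μ.IsAddRightInvariant]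

theorem lintegral_measure_line_section {S : Set E} (hS : MeasurableSet S) (u : E) (ν : Measure ℝ)
    [SFinite ν] : ∫⁻ v, ν {t | v + t • u ∈ S} ∂μ = μ S * ν univ := by
  have hA : MeasurableSet {z : E × ℝ | z.1 + z.2 • u ∈ S} :=
    (by fun_prop : Measurable fun z : E × ℝ => z.1 + z.2 • u) hS
  calc ∫⁻ v, ν {t | v + t • u ∈ S} ∂μ = ∫⁻ t, μ {v | v + t • u ∈ S} ∂ν :=
        (Measure.prod_apply hA).symm.trans (Measure.prod_apply_symm hA)
    _ = ∫⁻ _, μ S ∂ν := lintegral_congr fun t => measure_preimage_add_right μ (t • u) S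
    _ = μ S * ν univ := lintegral_const _

theorem two_mul_measure_le_of_line_section_le {S : Set E} (hS : MeasurableSet S)
    (hS1 : S ⊆ Metric.closedBall 0 1) {u : E} (hu : ‖u‖ ≤ 1) {K : ENNReal}
    (hK : ∀ v, volume {t : ℝ | v + t • u ∈ S} ≤ K) :
    2 * μ S ≤ K * μ (Metric.closedBall 0 2) := by
  have hnear : ∀ v, ∀ t ∈ Icc (-1 : ℝ) 1, v + t • u ∈ S → v ∈ Metric.closedBall (0 : E) 2 :=
    fun v t ht hv => by
      have hsum : ‖v + t • u‖ ≤ 1 := mem_closedBall_zero_iff.1 (hS1 hv)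
      have hsmul : ‖t • u‖ ≤ 1 := by
        rw [norm_smul]
        exact mul_le_one₀ (abs_le.2 ht) (norm_nonneg u) hu
      rw [mem_closedBall_zero_iff, ← add_sub_cancel_right v (t • u)]
      exact (norm_sub_le _ _).trans (by linarith)
  have hsection : ∀ v, volume.restrict (Icc (-1 : ℝ) 1) {t | v + t • u ∈ S} ≤
      (Metric.closedBall (0 : E) 2).indicator (fun _ => K) v := fun v => by
    by_cases hv : v ∈ Metric.closedBall (0 : E) 2
    · rw [indicator_of_mem hv]
      exact (Measure.restrict_apply_le _ _).trans (hK v)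
    · rw [Measure.restrict_apply' measurableSet_Icc, indicator_of_notMem hv,
        show {t | v + t • u ∈ S} ∩ Icc (-1 : ℝ) 1 = ∅ from
          eq_empty_of_forall_notMem fun t ht => hv (hnear v t ht.2 ht.1), measure_empty]
  calc 2 * μ S = μ S * volume.restrict (Icc (-1 : ℝ) 1) univ := by
        rw [Measure.restrict_apply_univ, Real.volume_Icc, mul_comm]
        norm_num
    _ = ∫⁻ v, volume.restrict (Icc (-1 : ℝ) 1) {t | v + t • u ∈ S} ∂μ :=
        (lintegral_measure_line_section hS u _).symm
    _ ≤ ∫⁻ v, (Metric.closedBall (0 : E) 2).indicator (fun _ => K) v ∂μ := lintegral_mono hsection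
    _ = K * μ (Metric.closedBall 0 2) := lintegral_indicator_const measurableSet_closedBall K

end LineSection

section InnerProductSpace

open scoped RealInnerProductSpace

variable {E : Type*} [NormedAddCommGroup E] [InnerProductSpace ℝ E] {e u : E}

-- The leading coefficient is `1 - b` along `e` and `-b` along `u`.
theorem exists_direction_quadraticForm_eq_quadratic (he : ‖e‖ = 1) (hu : ‖u‖ = 1)
    (heu : ⟪e, u⟫ = 0) (b : ℝ) :
    ∃ w : E, ‖w‖ = 1 ∧ ∃ p : ℝ, 1 / 2 ≤ |p| ∧ ∀ v : E, ∃ q c : ℝ, ∀ t : ℝ,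
      ⟪e, v + t • w⟫ ^ 2 - b * ‖v + t • w‖ ^ 2 = p * t ^ 2 + q * t + c := by
  have hexpand : ∀ (v w : E) (t : ℝ), ‖w‖ = 1 → ⟪e, v + t • w⟫ ^ 2 - b * ‖v + t • w‖ ^ 2 =
      (⟪e, v⟫ + t * ⟪e, w⟫) ^ 2 - b * (‖v‖ ^ 2 + 2 * (t * ⟪v, w⟫) + t ^ 2) := fun v w t hw => by
    rw [norm_add_sq_real, norm_smul, inner_add_right, inner_smul_right, inner_smul_right,
      hw, mul_one, Real.norm_eq_abs, sq_abs]
  rcases le_total b (1 / 2) with hb | hb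
  · refine ⟨e, he, 1 - b, (by linarith : 1 / 2 ≤ 1 - b).trans (le_abs_self _), fun v =>
      ⟨2 * (1 - b) * ⟪e, v⟫, ⟪e, v⟫ ^ 2 - b * ‖v‖ ^ 2, fun t => ?_⟩⟩
    rw [hexpand v e t he, real_inner_self_eq_norm_sq, he, real_inner_comm]
    ring
  · refine ⟨u, hu, -b, (abs_neg b).symm ▸ hb.trans (le_abs_self b), fun v =>
      ⟨-(2 * b * ⟪v, u⟫), ⟪e, v⟫ ^ 2 - b * ‖v‖ ^ 2, fun t => ?_⟩⟩
    rw [hexpand v u t hu, heu]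
    ring

theorem volume_closedBall_inter_quadricCone_le [FiniteDimensional ℝ E] [MeasurableSpace E]
    [BorelSpace E] (he : ‖e‖ = 1) (hu : ‖u‖ = 1) (heu : ⟪e, u⟫ = 0) (b : ℝ) {s : ℝ}
    (hs : 0 ≤ s) :
    volume {v : E | ‖v‖ ≤ 1 ∧ |⟪e, v⟫ ^ 2 - b * ‖v‖ ^ 2| ≤ s} ≤
      .ofReal (2 * √(2 * s)) * volume (Metric.closedBall (0 : E) 2) := by
  set S := {v : E | ‖v‖ ≤ 1 ∧ |⟪e, v⟫ ^ 2 - b * ‖v‖ ^ 2| ≤ s}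
  have hS : MeasurableSet S :=
    ((isClosed_le continuous_norm continuous_const).inter (isClosed_le
      (by fun_prop : Continuous fun v : E => |⟪e, v⟫ ^ 2 - b * ‖v‖ ^ 2|)
      continuous_const)).measurableSet
  obtain ⟨w, hw, p, hp, hquad⟩ := exists_direction_quadraticForm_eq_quadratic he hu heu b
  have hp0 : 0 < |p| := one_half_pos.trans_le hp
  have hsection : ∀ v, volume {t : ℝ | v + t • w ∈ S} ≤ .ofReal (4 * √(2 * s)) := fun v => by
    obtain ⟨q, c, hqc⟩ := hquad v
    calc volume {t : ℝ | v + t • w ∈ S} ≤ volume {t : ℝ | |p * t ^ 2 + q * t + c| ≤ s} :=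
          measure_mono fun t ht => (congrArg abs (hqc t)).symm.trans_le ht.2
      _ ≤ .ofReal (4 * √(s / |p|)) := volume_abs_quadratic_le (abs_pos.1 hp0) q c s
      _ ≤ .ofReal (4 * √(2 * s)) := by
        gcongr
        rw [div_le_iff₀ hp0]
        nlinarith
  have h := two_mul_measure_le_of_line_section_le (μ := volume) hS
    (fun v hv => mem_closedBall_zero_iff.2 hv.1) hw.le hsection
  rwa [show 4 * √(2 * s) = 2 * (2 * √(2 * s)) by ring, ENNReal.ofReal_mul zero_le_two,
    ENNReal.ofReal_ofNat, mul_assoc, ENNReal.mul_le_mul_iff_right two_ne_zero ENNReal.ofNat_ne_top]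
    at h

end InnerProductSpace

end ConeVolume

section UnitQuaternion

noncomputable instance : MeasurableSpace ℍ := borel ℍ

instance : BorelSpace ℍ := ⟨rfl⟩

/-- The radial projection `v ↦ v / |v|` onto the unit quaternions, with value `1` at `v = 0`. -/
noncomputable def radialProjection (v : ℍ) : UnitQuaternion :=
  open Classical in
  if h : v = 0 then 1 else ⟨NormedSpace.normalize v, by simp [h]⟩

theorem coe_radialProjection {v : ℍ} (hv : v ≠ 0) :
    (radialProjection v : ℍ) = NormedSpace.normalize v := by
  simp only [radialProjection, dif_neg hv]

theorem measurable_radialProjection : Measurable radialProjection := by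
  refine measurable_of_continuousOn_compl_singleton 0 ?_
  rw [Topology.IsInducing.subtypeVal.continuousOn_iff]
  refine ContinuousOn.congr ?_ fun v hv => coe_radialProjection hv
  exact (continuous_norm.continuousOn.inv₀ fun v hv => norm_ne_zero_iff.2 hv).smul continuousOn_id

theorem radialProjection_mul (g : UnitQuaternion) {v : ℍ} (hv : v ≠ 0) :
    radialProjection (g * v) = g * radialProjection v := by
  have hg : (g : ℍ) ≠ 0 := ne_zero_of_mem_unit_sphere g
  refine Subtype.ext ?_
  rw [coe_radialProjection (mul_ne_zero hg hv), Metric.unitSphere.coe_mul,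
    coe_radialProjection hv, NormedSpace.normalize, NormedSpace.normalize, norm_mul,
    norm_eq_of_mem_sphere, one_mul, mul_smul_comm]

/-- Left multiplication by a unit quaternion as a linear isometry of `ℍ`. -/
noncomputable def mulLeftIsometryEquiv (g : UnitQuaternion) : ℍ ≃ₗᵢ[ℝ] ℍ :=
  LinearIsometry.toLinearIsometryEquiv ⟨LinearMap.mulLeft ℝ (g : ℍ), fun v => by
    rw [LinearMap.mulLeft_apply, norm_mul, norm_eq_of_mem_sphere, one_mul]⟩ rfl

/-- The cone measure on the unit quaternions: the measure of `A` is the Lebesgue measure of the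
part of the cone over `A` in the unit ball. It is a multiple of the Haar measure. -/
noncomputable def coneMeasure : Measure UnitQuaternion :=
  (volume.restrict (Metric.closedBall (0 : ℍ) 1)).map radialProjection

theorem coneMeasure_apply {A : Set UnitQuaternion} (hA : MeasurableSet A) :
    coneMeasure A = volume (radialProjection ⁻¹' A ∩ Metric.closedBall 0 1) := by
  rw [coneMeasure, Measure.map_apply measurable_radialProjection hA,
    Measure.restrict_apply (measurable_radialProjection hA)]

theorem coneMeasure_univ : coneMeasure univ = volume (Metric.closedBall (0 : ℍ) 1) := by
  rw [coneMeasure_apply MeasurableSet.univ, preimage_univ, univ_inter]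

instance : IsFiniteMeasure coneMeasure :=
  ⟨coneMeasure_univ.trans_lt measure_closedBall_lt_top⟩

theorem radialProjection_preimage_mul_ae_eq (g : UnitQuaternion) (A : Set UnitQuaternion) :
    radialProjection ⁻¹' ((g * ·) ⁻¹' A) =ᵐ[volume]
      mulLeftIsometryEquiv g ⁻¹' (radialProjection ⁻¹' A) := by
  filter_upwards [Measure.ae_ne volume (0 : ℍ)] with v hv
  exact congrArg (· ∈ A) (radialProjection_mul g hv).symm

theorem measurePreserving_mulLeftIsometryEquiv (g : UnitQuaternion) :
    MeasurePreserving (mulLeftIsometryEquiv g) :=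
  (mulLeftIsometryEquiv g).measurePreserving

theorem coneMeasure_preimage_mul (g : UnitQuaternion) {A : Set UnitQuaternion}
    (hA : MeasurableSet A) : coneMeasure ((g * ·) ⁻¹' A) = coneMeasure A := by
  have hball : mulLeftIsometryEquiv g ⁻¹' Metric.closedBall 0 1 = Metric.closedBall 0 1 := by
    rw [LinearIsometryEquiv.preimage_closedBall, map_zero]
  rw [coneMeasure_apply ((continuous_const_mul g).measurable hA), coneMeasure_apply hA]
  calc volume (radialProjection ⁻¹' ((g * ·) ⁻¹' A) ∩ Metric.closedBall 0 1)
      = volume (mulLeftIsometryEquiv g ⁻¹' (radialProjection ⁻¹' A) ∩ Metric.closedBall 0 1) :=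
        measure_congr ((radialProjection_preimage_mul_ae_eq g A).inter (ae_eq_refl _))
    _ = volume (mulLeftIsometryEquiv g ⁻¹' (radialProjection ⁻¹' A ∩ Metric.closedBall 0 1)) := by
        rw [preimage_inter, hball]
    _ = volume (radialProjection ⁻¹' A ∩ Metric.closedBall 0 1) :=
        (measurePreserving_mulLeftIsometryEquiv g).measure_preimage
          ((measurable_radialProjection hA).inter measurableSet_closedBall).nullMeasurableSet

instance : Measure.IsMulLeftInvariant coneMeasure :=
  ⟨fun g => Measure.ext fun _ hA =>
    (Measure.map_apply (continuous_const_mul g).measurable hA).trans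
      (coneMeasure_preimage_mul g hA)⟩

/-- The Haar measure of the compact group of unit quaternions of total mass one. -/
noncomputable def unitHaar : Measure UnitQuaternion := Measure.haarMeasure ⊤

instance : Measure.IsHaarMeasure unitHaar := Measure.isHaarMeasure_haarMeasure ⊤

instance : IsProbabilityMeasure unitHaar :=
  ⟨Measure.haarMeasure_self (K₀ := (⊤ : TopologicalSpace.PositiveCompacts UnitQuaternion))⟩

instance : Measure.IsHaarMeasure torusMeasure := Measure.isHaarMeasure_haarMeasure ⊤

instance : IsProbabilityMeasure torusMeasure :=
  ⟨Measure.haarMeasure_self (K₀ := (⊤ : TopologicalSpace.PositiveCompacts Torus))⟩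

theorem torusMeasure_eq_prod : torusMeasure = unitHaar.prod unitHaar :=
  Measure.isHaarMeasure_eq_of_isProbabilityMeasure _ _

theorem coneMeasure_apply_eq_mul_unitHaar (A : Set UnitQuaternion) :
    coneMeasure A = volume (Metric.closedBall (0 : ℍ) 1) * unitHaar A := by
  have h := Measure.haarMeasure_unique coneMeasure
    (⊤ : TopologicalSpace.PositiveCompacts UnitQuaternion)
  rw [TopologicalSpace.PositiveCompacts.coe_top, coneMeasure_univ] at h
  exact congrArg (· A) h

theorem norm_mul_re_radialProjection (v : ℍ) : ‖v‖ * (radialProjection v : ℍ).re = v.re := by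
  rcases eq_or_ne v 0 with rfl | hv
  · simp only [norm_zero, zero_mul, Quaternion.re_zero]
  · rw [← smul_eq_mul, ← Quaternion.re_smul, coe_radialProjection hv,
      NormedSpace.norm_smul_normalize]

theorem inner_one_eq_re (v : ℍ) : inner ℝ 1 v = v.re := by
  rw [Quaternion.inner_def, one_mul, Quaternion.re_star]

theorem norm_coeComplex (z : ℂ) : ‖(z : ℍ)‖ = ‖z‖ := by
  rw [← sq_eq_sq₀ (norm_nonneg _) (norm_nonneg _), sq, ← Quaternion.normSq_eq_norm_mul_self,
    Quaternion.normSq_def', Complex.sq_norm, Complex.normSq_apply, Quaternion.re_coeComplex,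
    Quaternion.imI_coeComplex, Quaternion.imJ_coeComplex, Quaternion.imK_coeComplex]
  ring

theorem abs_re_unitQuaternion_le_one (x : UnitQuaternion) : |(x : ℍ).re| ≤ 1 := by
  simpa only [inner_one_eq_re, norm_one, norm_eq_of_mem_sphere, one_mul] using
    abs_real_inner_le_norm 1 (x : ℍ)

theorem abs_sq_re_sub_le {v : ℍ} {a r : ℝ} (hv : ‖v‖ ≤ 1) (hr : r ≤ 1)
    (h : |(radialProjection v : ℍ).re - a| ≤ r) : |v.re ^ 2 - a ^ 2 * ‖v‖ ^ 2| ≤ 3 * r := by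
  set t := (radialProjection v : ℍ).re
  have hfactor : v.re ^ 2 - a ^ 2 * ‖v‖ ^ 2 = ‖v‖ ^ 2 * ((t - a) * (t + a)) := by
    rw [← norm_mul_re_radialProjection]
    ring
  have hsum : |t + a| ≤ 3 :=
    calc |t + a| = |2 * t - (t - a)| := by ring_nf
      _ ≤ |2 * t| + |t - a| := abs_sub _ _
      _ ≤ 2 * 1 + 1 := by
        rw [abs_mul, abs_two]
        gcongr
        · exact abs_re_unitQuaternion_le_one _
        · exact h.trans hr
      _ = 3 := by norm_num
  rw [hfactor, abs_mul, abs_mul, abs_of_nonneg (sq_nonneg ‖v‖)]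
  have hr0 : 0 ≤ r := (abs_nonneg _).trans h
  calc ‖v‖ ^ 2 * (|t - a| * |t + a|) ≤ 1 * (r * 3) := by
        gcongr
        exact pow_le_one₀ (norm_nonneg v) hv
    _ = 3 * r := by ring

theorem coneMeasure_abs_re_sub_le (a : ℝ) {r : ℝ} (hr : 0 ≤ r) (hr1 : r ≤ 1) :
    coneMeasure {x : UnitQuaternion | |(x : ℍ).re - a| ≤ r} ≤
      .ofReal (2 * √(2 * (3 * r))) * volume (Metric.closedBall (0 : ℍ) 2) := by
  have hmeas : MeasurableSet {x : UnitQuaternion | |(x : ℍ).re - a| ≤ r} :=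
    (isClosed_le ((Quaternion.continuous_re.comp continuous_subtype_val).sub
      continuous_const).abs continuous_const).measurableSet
  have hI : ‖((Complex.I : ℂ) : ℍ)‖ = 1 := by rw [norm_coeComplex, Complex.norm_I]
  have horth : inner ℝ (1 : ℍ) ((Complex.I : ℂ) : ℍ) = 0 := by
    rw [inner_one_eq_re, Quaternion.re_coeComplex, Complex.I_re]
  rw [coneMeasure_apply hmeas]
  refine (measure_mono fun v hv => ?_).trans
    (volume_closedBall_inter_quadricCone_le norm_one hI horth (a ^ 2) (by positivity))
  have hv1 : ‖v‖ ≤ 1 := mem_closedBall_zero_iff.1 hv.2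
  refine ⟨hv1, ?_⟩
  rw [inner_one_eq_re]
  exact abs_sq_re_sub_le hv1 hr1 hv.1

theorem unitHaar_abs_re_sub_le (a : ℝ) {r : ℝ} (hr : 0 ≤ r) :
    unitHaar.real {x : UnitQuaternion | |(x : ℍ).re - a| ≤ r} ≤ 32 * √(6 * r) := by
  rcases le_total r 1 with hr1 | hr1
  · have hball : volume (Metric.closedBall (0 : ℍ) 2) =
        16 * volume (Metric.closedBall (0 : ℍ) 1) := by
      rw [Measure.addHaar_closedBall' _ _ zero_le_two, Quaternion.finrank_eq_four]
      norm_num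
    have hpos : volume (Metric.closedBall (0 : ℍ) 1) ≠ 0 :=
      (Metric.measure_closedBall_pos _ _ one_pos).ne'
    have h := coneMeasure_abs_re_sub_le a hr hr1
    rw [coneMeasure_apply_eq_mul_unitHaar, hball, mul_left_comm, mul_comm (volume _),
      ← mul_assoc, ← mul_assoc,
      ENNReal.mul_le_mul_iff_left hpos measure_closedBall_lt_top.ne] at h
    refine ENNReal.toReal_le_of_le_ofReal (by positivity) (h.trans_eq ?_)
    rw [← ENNReal.ofReal_ofNat 16, ← ENNReal.ofReal_mul (by norm_num)]
    ring_nf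
  · calc unitHaar.real {x : UnitQuaternion | |(x : ℍ).re - a| ≤ r} ≤ 1 := measureReal_le_one
      _ ≤ 32 * √(6 * 1) := by
        have : 1 ≤ √(6 * 1) := Real.one_le_sqrt.2 (by norm_num)
        linarith
      _ ≤ 32 * √(6 * r) := by gcongr

end UnitQuaternion

section Polynomial

open Polynomial

theorem exists_root_norm_sub_lt {K : Type*} [NormedField K] {Q : K[X]} (hQ : Q.Splits) {s : ℝ}
    (hs : 0 ≤ s) {z : K} (hz : ‖Q.eval z‖ < ‖Q.leadingCoeff‖ * s ^ Q.natDegree) :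
    ∃ w ∈ Q.roots, ‖z - w‖ < s := by
  by_contra! hfar
  have hprod : s ^ Q.natDegree ≤ ‖(Q.roots.map fun w => z - w).prod‖ := by
    rw [← normHom_apply, map_multiset_prod, Multiset.map_map, hQ.natDegree_eq_card_roots,
      ← Multiset.prod_replicate, ← Multiset.map_const']
    exact Multiset.prod_map_le_prod_map₀ _ _ (fun _ _ => hs) hfar
  rw [hQ.eval_eq_prod_roots, norm_mul] at hz
  exact hz.not_ge (mul_le_mul_of_nonneg_left hprod (norm_nonneg _))

theorem sq_norm_smul_add_algebraMap (x : ℍ) (a b : ℝ) :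
    ‖a • x + algebraMap ℝ ℍ b‖ ^ 2 = a ^ 2 * ‖x‖ ^ 2 + 2 * a * b * x.re + b ^ 2 := by
  have hre : inner ℝ x (algebraMap ℝ ℍ b) = b * x.re := by
    rw [Algebra.algebraMap_eq_smul_one, inner_smul_right, real_inner_comm, inner_one_eq_re]
  rw [norm_add_sq_real, inner_smul_left, hre, norm_smul, norm_algebraMap', mul_pow,
    Real.norm_eq_abs, Real.norm_eq_abs, sq_abs, sq_abs, conj_trivial]
  ring

theorem sq_sub_two_re_smul_add_sq_norm (x : ℍ) :
    x ^ 2 - (2 * x.re) • x + algebraMap ℝ ℍ (‖x‖ ^ 2) = 0 := by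
  have htrace : algebraMap ℝ ℍ (2 * x.re) = x + star x := x.self_add_star'.symm
  have hnorm : algebraMap ℝ ℍ (‖x‖ ^ 2) = star x * x := by
    rw [sq, ← Quaternion.normSq_eq_norm_mul_self]
    exact x.star_mul_self.symm
  rw [Algebra.smul_def, htrace, hnorm, sq, add_mul]
  abel

theorem exists_aeval_eq_smul_add_algebraMap (q : ℝ[X]) (t n : ℝ) :
    ∃ a b : ℝ, ∀ x : ℍ, x.re = t → ‖x‖ = n → aeval x q = a • x + algebraMap ℝ ℍ b := by
  obtain ⟨m, hm⟩ : ∃ m : ℝ[X], m = X ^ 2 - C (2 * t) * X + C (n ^ 2) := ⟨_, rfl⟩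
  have hmonic : m.Monic := by
    rw [hm]
    monicity!
  have hdeg : (q %ₘ m).natDegree ≤ 1 := by
    have hm2 : m.natDegree = 2 := by
      rw [hm]
      compute_degree!
    have := natDegree_modByMonic_lt q hmonic fun h => by simp [h] at hm2
    omega
  obtain ⟨a, b, hab⟩ := exists_eq_X_add_C_of_natDegree_le_one hdeg
  refine ⟨a, b, fun x hre hnorm => ?_⟩
  have hroot : aeval x m = 0 := by
    simpa [hm, hre, hnorm, Algebra.smul_def] using sq_sub_two_re_smul_add_sq_norm x
  rw [← aeval_modByMonic_eq_self_of_root hroot, hab, map_add, map_mul, aeval_C, aeval_C, aeval_X,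
    ← Algebra.smul_def]

theorem norm_aeval_eq_of_re_eq_of_norm_eq {x y : ℍ} (hre : x.re = y.re) (hnorm : ‖x‖ = ‖y‖)
    (q : ℝ[X]) : ‖aeval x q‖ = ‖aeval y q‖ := by
  obtain ⟨a, b, h⟩ := exists_aeval_eq_smul_add_algebraMap q y.re ‖y‖
  rw [h x hre hnorm, h y rfl rfl, ← sq_eq_sq₀ (norm_nonneg _) (norm_nonneg _),
    sq_norm_smul_add_algebraMap, sq_norm_smul_add_algebraMap, hre, hnorm]

theorem exists_complex_norm_aeval_eq (x : ℍ) :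
    ∃ z : ℂ, z.re = x.re ∧ ∀ q : ℝ[X], ‖aeval x q‖ = ‖aeval z q‖ := by
  let z : ℂ := ⟨x.re, ‖x.im‖⟩
  have hnorm : ‖x‖ = ‖(z : ℍ)‖ := by
    rw [norm_coeComplex, ← sq_eq_sq₀ (norm_nonneg _) (norm_nonneg _), Complex.sq_norm,
      Complex.normSq_mk, sq, ← Quaternion.normSq_eq_norm_mul_self,
      ← Quaternion.normSq_eq_norm_mul_self, Quaternion.normSq_def', Quaternion.normSq_def']
    simp only [Quaternion.re_im, Quaternion.imI_im, Quaternion.imJ_im, Quaternion.imK_im]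
    ring
  refine ⟨z, rfl, fun q => ?_⟩
  rw [← norm_coeComplex, ← Quaternion.coe_ofComplex, ← aeval_algHom_apply]
  exact norm_aeval_eq_of_re_eq_of_norm_eq (Quaternion.re_coeComplex z).symm hnorm q

theorem unitHaar_norm_aeval_lt_le (q : ℝ[X]) {s : ℝ} (hs : 0 ≤ s) :
    unitHaar.real {x | ‖aeval (x : ℍ) q‖ < |q.leadingCoeff| * s ^ q.natDegree} ≤
      q.natDegree * (32 * √(6 * s)) := by
  set Q : ℂ[X] := q.map (algebraMap ℝ ℂ)
  have hcover : {x : UnitQuaternion | ‖aeval (x : ℍ) q‖ < |q.leadingCoeff| * s ^ q.natDegree} ⊆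
      ⋃ w ∈ Q.roots.toFinset, {x | |(x : ℍ).re - w.re| ≤ s} := by
    intro x hx
    obtain ⟨z, hzre, hz⟩ := exists_complex_norm_aeval_eq (x : ℍ)
    have hzQ : ‖Q.eval z‖ < ‖Q.leadingCoeff‖ * s ^ Q.natDegree := by
      rw [eval_map_algebraMap, ← hz, leadingCoeff_map, natDegree_map, norm_algebraMap']
      exact hx
    obtain ⟨w, hw, hzw⟩ := exists_root_norm_sub_lt (IsAlgClosed.splits Q) hs hzQ
    refine mem_biUnion (Multiset.mem_toFinset.2 hw) ?_
    rw [mem_ofPred_eq, ← hzre, ← Complex.sub_re]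
    exact (Complex.abs_re_le_norm _).trans hzw.le
  have hcard : (Q.roots.toFinset.card : ℝ) ≤ q.natDegree := by
    rw [← natDegree_map (algebraMap ℝ ℂ)]
    exact_mod_cast (Multiset.toFinset_card_le _).trans (card_roots' Q)
  calc _ ≤ unitHaar.real (⋃ w ∈ Q.roots.toFinset, {x | |(x : ℍ).re - w.re| ≤ s}) :=
        measureReal_mono hcover (measure_ne_top _ _)
    _ ≤ ∑ w ∈ Q.roots.toFinset, unitHaar.real {x | |(x : ℍ).re - w.re| ≤ s} :=
        measureReal_biUnion_finset_le _ _
    _ ≤ ∑ w ∈ Q.roots.toFinset, 32 * √(6 * s) :=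
        Finset.sum_le_sum fun w _ => unitHaar_abs_re_sub_le w.re hs
    _ = Q.roots.toFinset.card * (32 * √(6 * s)) := by rw [Finset.sum_const, nsmul_eq_mul]
    _ ≤ q.natDegree * (32 * √(6 * s)) := by gcongr

section MapCoeff

variable {A B : Type*} [Semiring A] [Semiring B] (f : A →+ B) (p : A[X])

/-- The polynomial obtained by applying an additive map to the coefficients. Unlike for
`Polynomial.map`, the map need not be multiplicative: conjugation and evaluation of quaternionic
polynomials are not. -/
noncomputable def mapCoeff : B[X] := p.sum fun i c => monomial i (f c)

@[simp]
theorem coeff_mapCoeff (n : ℕ) : (mapCoeff f p).coeff n = f (p.coeff n) := by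
  rw [mapCoeff, sum_def, finsetSum_coeff]
  simp only [coeff_monomial, Finset.sum_ite_eq', ite_eq_left_iff, notMem_support_iff]
  intro h
  rw [h, map_zero]

theorem mapCoeff_add (q : A[X]) : mapCoeff f (p + q) = mapCoeff f p + mapCoeff f q := by
  ext n
  simp only [coeff_mapCoeff, coeff_add, map_add]

theorem mapCoeff_monomial (n : ℕ) (c : A) : mapCoeff f (monomial n c) = monomial n (f c) := by
  ext k
  simp only [coeff_mapCoeff, coeff_monomial, apply_ite f, map_zero]

variable {f p}

theorem natDegree_mapCoeff (h : f p.leadingCoeff ≠ 0) : (mapCoeff f p).natDegree = p.natDegree := by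
  refine natDegree_eq_of_le_of_coeff_ne_zero (natDegree_le_iff_coeff_eq_zero.2 fun n hn => ?_) ?_
  · rw [coeff_mapCoeff, coeff_eq_zero_of_natDegree_lt hn, map_zero]
  · rwa [coeff_mapCoeff]

theorem leadingCoeff_mapCoeff (h : f p.leadingCoeff ≠ 0) :
    (mapCoeff f p).leadingCoeff = f p.leadingCoeff := by
  rw [leadingCoeff, natDegree_mapCoeff h, coeff_mapCoeff, leadingCoeff]

end MapCoeff

section CoeffNorm

variable {A : Type*}

/-- The `ℓ¹` norm of the coefficients of a polynomial. -/
noncomputable def coeffNorm [NormedRing A] (p : A[X]) : ℝ := p.sum fun _ c => ‖c‖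

theorem coeffNorm_nonneg [NormedRing A] (p : A[X]) : 0 ≤ coeffNorm p :=
  Finset.sum_nonneg fun _ _ => norm_nonneg _

theorem coeffNorm_eq_sum [NormedRing A] {p : A[X]} {s : Finset ℕ} (hs : p.support ⊆ s) :
    coeffNorm p = ∑ i ∈ s, ‖p.coeff i‖ :=
  sum_eq_of_subset _ (fun _ => norm_zero) hs

theorem coeffNorm_pos [NormedRing A] {p : A[X]} (hp : p ≠ 0) : 0 < coeffNorm p :=
  Finset.sum_pos (fun _ hi => norm_pos_iff.2 (mem_support_iff.1 hi)) (nonempty_support_iff.2 hp)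

theorem eval_mul_eq_sum [Semiring A] (p q : A[X]) (x : A) :
    (p * q).eval x = p.sum fun i c => c * q.eval x * x ^ i := by
  conv_lhs => rw [← p.sum_monomial_eq, sum_def, Finset.sum_mul, eval_finsetSum]
  refine Finset.sum_congr rfl fun i _ => ?_
  rw [← C_mul_X_pow_eq_monomial, mul_assoc, X_pow_mul, ← mul_assoc, eval_mul_X_pow, eval_C_mul]

theorem norm_eval_mul_le [NormedRing A] [NormOneClass A] (p q : A[X]) {x : A} (hx : ‖x‖ ≤ 1) :
    ‖(p * q).eval x‖ ≤ coeffNorm p * ‖q.eval x‖ := by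
  rw [eval_mul_eq_sum, coeffNorm, sum_def, sum_def, Finset.sum_mul]
  refine norm_sum_le_of_le _ fun i _ => ?_
  calc ‖p.coeff i * q.eval x * x ^ i‖ ≤ ‖p.coeff i‖ * ‖q.eval x‖ * ‖x‖ ^ i :=
        norm_mul₃_le.trans (mul_le_mul_of_nonneg_left (norm_pow_le x i) (by positivity))
    _ ≤ ‖p.coeff i‖ * ‖q.eval x‖ :=
        mul_le_of_le_one_right (by positivity) (pow_le_one₀ (norm_nonneg x) hx)

end CoeffNorm

section Symmetrization

variable (r : ℍ [X])

/-- The regular conjugate of a quaternionic polynomial: conjugation of the coefficients. -/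
noncomputable def regularConj : ℍ [X] := mapCoeff (starAddEquiv : ℍ ≃+ ℍ) r

theorem coeff_regularConj (n : ℕ) : (regularConj r).coeff n = star (r.coeff n) :=
  coeff_mapCoeff _ _ n

theorem coeffNorm_regularConj : coeffNorm (regularConj r) = coeffNorm r := by
  have hsupport : (regularConj r).support ⊆ r.support := fun n => by
    simp only [mem_support_iff, coeff_regularConj, ne_eq, star_eq_zero, imp_self]
  rw [coeffNorm_eq_sum hsupport]
  simp only [coeff_regularConj, norm_star, coeffNorm, sum_def]

theorem star_coeff_regularConj_mul_self (n : ℕ) :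
    star ((regularConj r * r).coeff n) = (regularConj r * r).coeff n := by
  rw [coeff_mul, star_sum, ← Finset.Nat.sum_antidiagonal_swap]
  simp only [coeff_regularConj, star_mul, star_star, Prod.fst_swap, Prod.snd_swap]

/-- The symmetrization of a quaternionic polynomial: its product with its regular conjugate,
which has real coefficients. -/
noncomputable def symmetrization : ℝ[X] :=
  mapCoeff (AddMonoidHom.mk' (fun v : ℍ => v.re) Quaternion.re_add) (regularConj r * r)

theorem map_symmetrization : (symmetrization r).map (algebraMap ℝ ℍ) = regularConj r * r := by
  ext1 n
  rw [coeff_map, symmetrization, coeff_mapCoeff]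
  exact (Quaternion.star_eq_self.1 (star_coeff_regularConj_mul_self r n)).symm

theorem norm_aeval_symmetrization_le {x : ℍ} (hx : ‖x‖ ≤ 1) :
    ‖aeval x (symmetrization r)‖ ≤ coeffNorm r * ‖r.eval x‖ := by
  rw [aeval_def, ← eval_map, map_symmetrization, ← coeffNorm_regularConj]
  exact norm_eval_mul_le _ _ hx

theorem natDegree_regularConj : (regularConj r).natDegree = r.natDegree := by
  rcases eq_or_ne r 0 with rfl | hr
  · exact congrArg natDegree (ext fun n => by rw [coeff_regularConj, coeff_zero, star_zero])
  · exact natDegree_mapCoeff (star_ne_zero.2 (leadingCoeff_ne_zero.2 hr))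

theorem leadingCoeff_regularConj : (regularConj r).leadingCoeff = star r.leadingCoeff := by
  rw [leadingCoeff, natDegree_regularConj, coeff_regularConj, leadingCoeff]

theorem natDegree_symmetrization : (symmetrization r).natDegree = 2 * r.natDegree := by
  rw [← natDegree_map (algebraMap ℝ ℍ), map_symmetrization, two_mul]
  rcases eq_or_ne r 0 with rfl | hr
  · rw [mul_zero, natDegree_zero]
  · have hconj : regularConj r ≠ 0 := by
      rwa [← leadingCoeff_ne_zero, leadingCoeff_regularConj, star_ne_zero, leadingCoeff_ne_zero]
    rw [natDegree_mul hconj hr, natDegree_regularConj]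

theorem leadingCoeff_symmetrization : (symmetrization r).leadingCoeff = ‖r.leadingCoeff‖ ^ 2 := by
  apply (algebraMap ℝ ℍ).injective
  rw [← leadingCoeff_map, map_symmetrization, leadingCoeff_mul, leadingCoeff_regularConj,
    Quaternion.star_mul_self, Quaternion.normSq_eq_norm_mul_self, sq]
  rfl

end Symmetrization

theorem norm_aeval_symmetrization_le_star (r : ℍ [X]) {x : ℍ} (hx : ‖x‖ ≤ 1) :
    ‖aeval x (symmetrization r)‖ ≤ coeffNorm r * ‖r.eval (star x)‖ := by
  rw [norm_aeval_eq_of_re_eq_of_norm_eq (Quaternion.re_star x).symm (norm_star x).symm]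
  exact norm_aeval_symmetrization_le r ((norm_star x).trans_le hx)

theorem unitHaar_norm_eval_star_le {r : ℍ [X]} (hr : r ≠ 0) {ε : ℝ} (hε : 0 < ε) :
    unitHaar.real {x | ‖r.eval (star (x : ℍ))‖ ≤ ε} ≤
      (64 * √6 * r.natDegree + 1) * (coeffNorm r * ε / ‖r.leadingCoeff‖ ^ 2) ^
        (1 / 2 * ((2 * r.natDegree + 1 : ℕ) : ℝ)⁻¹) := by
  have hlead : 0 < ‖r.leadingCoeff‖ := norm_pos_iff.2 (leadingCoeff_ne_zero.2 hr)
  set ρ := coeffNorm r * ε / ‖r.leadingCoeff‖ ^ 2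
  have hρ : 0 < ρ := by have := coeffNorm_pos hr; positivity
  set s := ρ ^ ((2 * r.natDegree + 1 : ℕ) : ℝ)⁻¹
  have hs : 0 < s := Real.rpow_pos_of_pos hρ _
  have hsρ : s ^ (2 * r.natDegree + 1) = ρ := Real.rpow_inv_natCast_pow hρ.le (Nat.succ_ne_zero _)
  rw [mul_comm (1 / 2 : ℝ), Real.rpow_mul hρ.le, ← Real.sqrt_eq_rpow]
  rcases le_or_gt 1 s with hs1 | hs1
  · have : 1 ≤ √s := Real.one_le_sqrt.2 hs1
    have : 0 ≤ 64 * √6 * r.natDegree := by positivity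
    exact measureReal_le_one.trans (by nlinarith)
  have hsub : {x : UnitQuaternion | ‖r.eval (star (x : ℍ))‖ ≤ ε} ⊆ {x | ‖aeval (x : ℍ)
      (symmetrization r)‖ < |(symmetrization r).leadingCoeff| * s ^ (symmetrization r).natDegree} :=
    fun x hx => by
      have hρs : ρ < s ^ (2 * r.natDegree) := by
        rw [← hsρ]
        exact pow_lt_pow_right_of_lt_one₀ hs hs1 (Nat.lt_succ_self _)
      rw [mem_ofPred_eq, leadingCoeff_symmetrization, natDegree_symmetrization, abs_sq]
      calc ‖aeval (x : ℍ) (symmetrization r)‖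
          ≤ coeffNorm r * ‖r.eval (star (x : ℍ))‖ :=
            norm_aeval_symmetrization_le_star r (norm_eq_of_mem_sphere x).le
        _ ≤ coeffNorm r * ε := mul_le_mul_of_nonneg_left hx (coeffNorm_nonneg r)
        _ < ‖r.leadingCoeff‖ ^ 2 * s ^ (2 * r.natDegree) := by
          rwa [← div_lt_iff₀' (by positivity)]
  calc _ ≤ (symmetrization r).natDegree * (32 * √(6 * s)) :=
        (measureReal_mono hsub (measure_ne_top _ _)).trans
          (unitHaar_norm_aeval_lt_le (symmetrization r) hs.le)
    _ = 64 * √6 * r.natDegree * √s := by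
        rw [natDegree_symmetrization, Real.sqrt_mul (by norm_num)]
        push_cast
        ring
    _ ≤ (64 * √6 * r.natDegree + 1) * √s := by gcongr; linarith

theorem hasPowerSublevelBound_norm_eval_star {r : ℍ [X]} (hr : r ≠ 0) :
    HasPowerSublevelBound unitHaar fun x => ‖r.eval (star (x : ℍ))‖ := by
  have hlead : 0 < ‖r.leadingCoeff‖ := norm_pos_iff.2 (leadingCoeff_ne_zero.2 hr)
  have hcoeff : 0 < coeffNorm r := coeffNorm_pos hr
  have hδ : (0 : ℝ) < 1 / 2 * ((2 * r.natDegree + 1 : ℕ) : ℝ)⁻¹ := by positivity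
  refine ⟨(64 * √6 * r.natDegree + 1) * (coeffNorm r / ‖r.leadingCoeff‖ ^ 2) ^
    (1 / 2 * ((2 * r.natDegree + 1 : ℕ) : ℝ)⁻¹), by positivity, _, hδ, fun ε hε => ?_⟩
  rw [mul_assoc, ← Real.mul_rpow (by positivity) hε.le, div_mul_eq_mul_div]
  exact unitHaar_norm_eval_star_le hr hε

section Bivariate

/-- The polynomial in the outer variable obtained from a polynomial in two variables by
evaluating the inner variable. -/
noncomputable def evalCoeff (y : ℍ) (p : ℍ [X][X]) : ℍ [X] := mapCoeff (leval y).toAddMonoidHom p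

theorem coeff_evalCoeff (y : ℍ) (p : ℍ [X][X]) (n : ℕ) :
    (evalCoeff y p).coeff n = (p.coeff n).eval y :=
  coeff_mapCoeff _ _ n

theorem support_evalCoeff_subset (y : ℍ) (p : ℍ [X][X]) : (evalCoeff y p).support ⊆ p.support :=
  fun n => by
    simp only [mem_support_iff, coeff_evalCoeff]
    exact mt fun h => by rw [h, eval_zero]

theorem eval_evalCoeff (x y : ℍ) (p : ℍ [X][X]) :
    (evalCoeff y p).eval x = ∑ i ∈ p.support, (p.coeff i).eval y * x ^ i := by
  rw [eval_eq_sum, sum_eq_of_subset (fun i c => c * x ^ i) (fun _ => zero_mul _)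
    (support_evalCoeff_subset y p)]
  simp only [coeff_evalCoeff]

theorem continuous_norm_eval_evalCoeff_star (p : ℍ [X][X]) :
    Continuous fun z : Torus => ‖(evalCoeff (star (z.2 : ℍ)) p).eval (star (z.1 : ℍ))‖ := by
  simp only [eval_evalCoeff]
  have hx : Continuous fun z : Torus => star (z.1 : ℍ) :=
    (continuous_subtype_val.comp continuous_fst).star
  have hy : Continuous fun z : Torus => star (z.2 : ℍ) :=
    (continuous_subtype_val.comp continuous_snd).star
  exact (continuous_finsetSum _ fun i _ =>
    ((p.coeff i).continuous.comp hy).mul (hx.pow i)).norm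

theorem exists_coeffNorm_evalCoeff_star_le (p : ℍ [X][X]) :
    ∃ M : ℝ, ∀ y : UnitQuaternion, coeffNorm (evalCoeff (star (y : ℍ)) p) ≤ M := by
  have hcont : Continuous fun y : UnitQuaternion => coeffNorm (evalCoeff (star (y : ℍ)) p) := by
    simp only [coeffNorm_eq_sum (support_evalCoeff_subset _ p), coeff_evalCoeff]
    exact continuous_finsetSum _ fun i _ =>
      ((p.coeff i).continuous.comp continuous_subtype_val.star).norm
  obtain ⟨M, hM⟩ := (isCompact_range hcont).bddAbove
  exact ⟨M, fun y => hM (mem_range_self y)⟩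

theorem hasPowerSublevelBound_norm_eval_evalCoeff_star {p : ℍ [X][X]} (hp : p ≠ 0) :
    HasPowerSublevelBound (unitHaar.prod unitHaar)
      fun z : Torus => ‖(evalCoeff (star (z.2 : ℍ)) p).eval (star (z.1 : ℍ))‖ := by
  obtain ⟨M, hM⟩ := exists_coeffNorm_evalCoeff_star_le p
  have hM0 : 0 ≤ M := (coeffNorm_nonneg _).trans (hM 1)
  have hlead : p.leadingCoeff ≠ 0 := leadingCoeff_ne_zero.2 hp
  set δ : ℝ := 1 / 2 * ((2 * p.natDegree + 1 : ℕ) : ℝ)⁻¹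
  set C : ℝ := 64 * √6 * p.natDegree + 1
  refine HasPowerSublevelBound.prod (C := C * M ^ δ) (δ := δ)
    (continuous_norm_eval_evalCoeff_star p).measurable ?_
    (hasPowerSublevelBound_norm_eval_star hlead).sq (by positivity) (by positivity) ?_
  · exact ((p.leadingCoeff.continuous.comp continuous_subtype_val.star).norm.pow 2).measurable
  intro y hy ε hε
  have hy0 : p.leadingCoeff.eval (star (y : ℍ)) ≠ 0 := fun h => by
    rw [h, norm_zero] at hy
    norm_num at hy
  have hlead_eq : (evalCoeff (star (y : ℍ)) p).leadingCoeff = p.leadingCoeff.eval (star (y : ℍ)) :=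
    leadingCoeff_mapCoeff hy0
  have hdeg : (evalCoeff (star (y : ℍ)) p).natDegree = p.natDegree := natDegree_mapCoeff hy0
  have hne : evalCoeff (star (y : ℍ)) p ≠ 0 := by
    rwa [← leadingCoeff_ne_zero, hlead_eq]
  have hbound := unitHaar_norm_eval_star_le hne hε
  rw [hlead_eq, hdeg, mul_div_assoc] at hbound
  rw [mul_assoc, ← Real.mul_rpow hM0 (by positivity)]
  refine hbound.trans ?_
  have hcoeff := hM y
  have hcoeff0 := coeffNorm_nonneg (evalCoeff (star (y : ℍ)) p)
  gcongr

theorem exists_eval_evalCoeff_eq (a : ℕ × ℕ →₀ ℍ) :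
    ∃ p : ℍ [X][X], ∀ x y : ℍ,
      (a.sum fun l c => x ^ l.1 * y ^ l.2 * c) = star ((evalCoeff (star y) p).eval (star x)) := by
  induction a using Finsupp.induction_linear with
  | zero => exact ⟨0, fun x y => by simp [eval_evalCoeff]⟩
  | add a b iha ihb =>
    obtain ⟨p, hp⟩ := iha
    obtain ⟨q, hq⟩ := ihb
    refine ⟨p + q, fun x y => ?_⟩
    rw [Finsupp.sum_add_index' (fun _ => mul_zero _) (fun _ => mul_add _), hp, hq, evalCoeff,
      evalCoeff, evalCoeff, mapCoeff_add, eval_add, star_add]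
  | single l c =>
    refine ⟨monomial l.1 (monomial l.2 (star c)), fun x y => ?_⟩
    rw [Finsupp.sum_single_index (mul_zero _), evalCoeff, mapCoeff_monomial, eval_monomial]
    simp [mul_assoc]

end Bivariate

theorem IsSliceRegularPolynomial.exists_polynomial {P : ℍ → ℍ → ℍ}
    (hP : IsSliceRegularPolynomial P) :
    ∃ p : ℍ [X][X], ∀ x y : ℍ, P x y = star ((evalCoeff (star y) p).eval (star x)) := by
  obtain ⟨a, ha⟩ := hP
  simpa only [ha] using exists_eval_evalCoeff_eq a

theorem IsSliceRegularPolynomial.continuous_norm {P : ℍ → ℍ → ℍ}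
    (hP : IsSliceRegularPolynomial P) : Continuous fun z : Torus => ‖P z.1 z.2‖ := by
  obtain ⟨p, hp⟩ := hP.exists_polynomial
  simpa only [hp, norm_star] using continuous_norm_eval_evalCoeff_star p

theorem IsSliceRegularPolynomial.hasPowerSublevelBound_norm {P : ℍ → ℍ → ℍ}
    (hP : IsSliceRegularPolynomial P) (hP0 : P ≠ 0) :
    HasPowerSublevelBound torusMeasure fun z => ‖P z.1 z.2‖ := by
  obtain ⟨p, hp⟩ := hP.exists_polynomial
  have hp0 : p ≠ 0 := by
    rintro rfl
    exact hP0 (funext₂ fun x y => by simp [hp, eval_evalCoeff])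
  simpa only [torusMeasure_eq_prod, hp, norm_star] using
    hasPowerSublevelBound_norm_eval_evalCoeff_star hp0

end Polynomial
end QuaternionMahler

theorem mainTheorem9 (P : ℍ → ℍ → ℍ) (hP : IsSliceRegularPolynomial P) (hP0 : P ≠ 0) :
    (∃ C : ℝ, 0 < C ∧ ∃ δ : ℝ, 0 < δ ∧ ∀ ε : ℝ, 0 < ε →
      torusMeasure.real {p : Torus | ‖P p.1 p.2‖ ≤ ε} ≤ C * ε ^ δ) ∧
    MeasureTheory.Integrable (logAbs P) torusMeasure ∧
    HasImproperRiemannIntegral torusMeasure (regularSet P) (logAbs P) (mahlerMeasure P) := by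
  have hbound : HasPowerSublevelBound torusMeasure fun p => ‖P p.1 p.2‖ :=
    hP.hasPowerSublevelBound_norm hP0
  have hcont : Continuous fun p : Torus => ‖P p.1 p.2‖ := hP.continuous_norm
  have hnonneg : ∀ p : Torus, 0 ≤ ‖P p.1 p.2‖ := fun _ => norm_nonneg _
  obtain ⟨M, hM⟩ := (isCompact_range hcont).bddAbove
  have hint : MeasureTheory.Integrable (logAbs P) torusMeasure :=
    hbound.integrable_log hcont.measurable hnonneg fun p => hM (Set.mem_range_self p)
  have hnull : torusMeasure {p | ‖P p.1 p.2‖ = 0} = 0 :=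
    MeasureTheory.measure_mono_null (fun _ hp => le_of_eq hp) hbound.measure_le_zero
  have hregular : regularSet P = {p | ‖P p.1 p.2‖ ≠ 0} := Set.ext fun _ => norm_ne_zero_iff.symm
  exact ⟨hbound, hint, hregular ▸ hasImproperRiemannIntegral_log hcont hnonneg hnull hint⟩
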